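/- Let $p>0$. For $n\ge 1$ let $\gamma_p$ be the probability measure on $\mathbb R^n$ with density $\varphi_p(y)=c_{n,p}e^{-|y|^p/p}$, where $|\cdot|$ is the Euclidean norm and $c_{n,p}$ is the normalizing constant. For a convex set $Q\subset\mathbb R^n$ with nonempty interior, define its $\gamma_p$-surface area by $$\gamma_p(\partial Q)=\liminf_{\varepsilon\to+0}\frac{\gamma_p\big((Q+\varepsilon B_2^n)\setminus Q\big)}{\varepsilon},$$ where $B_2^n$ is the closed Euclidean unit ball. By a convex polytope we mean an intersection of finitely many closed half-spaces that has nonempty interior (it may be bounded or unbounded); by its faces we mean its facets, i.e. its faces of dimension $n-1$. Then there is a constant $C(p)>0$, depending only on $p$, such that for every $n\ge 1$, every $K\ge 2$ and every convex polytope $P_K\subset\mathbb R^n$ with exactly $K$ faces, $$\gamma_p(\partial P_K)\le C(p)\,n^{\frac12-\frac1p}\sqrt{\log K}.$$ (For bounded $P_K$ the condition $K\ge 2$ holds automatically.) -/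

import Mathlib

open scoped Pointwise Topology ENNReal

noncomputable section

/-- Normalizing constant `c_{n,p} = (∫ exp (-|y|^p / p) dy)⁻¹`. -/
def expNormConst (n : ℕ) (p : ℝ) : ℝ :=
  (∫ y : EuclideanSpace ℝ (Fin n), Real.exp (-(‖y‖ ^ p / p)))⁻¹

/-- The density `φ_p(y) = c_{n,p} exp (-|y|^p / p)`. -/
def expDensity (n : ℕ) (p : ℝ) (y : EuclideanSpace ℝ (Fin n)) : ℝ :=
  expNormConst n p * Real.exp (-(‖y‖ ^ p / p))

/-- The rotation invariant measure `γ_p` on `ℝⁿ` with density `φ_p`. -/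
def expMeasure (n : ℕ) (p : ℝ) : MeasureTheory.Measure (EuclideanSpace ℝ (Fin n)) :=
  MeasureTheory.volume.withDensity (fun y => ENNReal.ofReal (expDensity n p y))

/-- The `γ_p`-surface area of `Q`:
`γ_p(∂Q) = liminf_{ε → 0+} γ_p((Q + ε B) \ Q) / ε`, with `B` the closed unit ball. -/
def expSurfaceArea (n : ℕ) (p : ℝ) (Q : Set (EuclideanSpace ℝ (Fin n))) : ℝ≥0∞ :=
  Filter.liminf
    (fun ε : ℝ =>
      expMeasure n p ((Q + ε • Metric.closedBall (0 : EuclideanSpace ℝ (Fin n)) 1) \ Q)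
        / ENNReal.ofReal ε)
    (𝓝[>] (0 : ℝ))

/-- A (full-dimensional, bounded or unbounded) convex polytope: a set with nonempty interior
that is the intersection of finitely many closed half-spaces. -/
def IsConvexPolytope {n : ℕ} (P : Set (EuclideanSpace ℝ (Fin n))) : Prop :=
  (interior P).Nonempty ∧
    ∃ (m : ℕ) (a : Fin m → EuclideanSpace ℝ (Fin n)) (b : Fin m → ℝ),
      (∀ i, a i ≠ 0) ∧ P = {x | ∀ i, inner ℝ (a i) x ≤ b i}

/-- The facets of `P`: the nonempty exposed faces (sets of maximizers over `P` of a linear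
functional) of dimension `n - 1`. -/
def polytopeFacets {n : ℕ} (P : Set (EuclideanSpace ℝ (Fin n))) :
    Set (Set (EuclideanSpace ℝ (Fin n))) :=
  {F | F.Nonempty ∧ IsExposed ℝ P F ∧ Module.finrank ℝ (vectorSpan ℝ F) + 1 = n}

end

open MeasureTheory Set

/-! Let `P` be cut out by at most `K` half-spaces with unit normals `a i`. A point within `ε` of `P`
but outside it violates some constraint, and none by more than `ε`. Assigning it to the most
violated constraint gives thin pieces inside disjoint cells, each cell stable under outward
translation along its normal (`add_smul_mem_maximizerCell`). Sweeping a piece over a length `τ`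
covers each point for time at most `ε`. If the weight loses at most a factor `M` along the sweep,
the piece has mass at most `ε M / τ` times that of the swept region (`setLIntegral_le_of_sweep`).
Outward sweeps stay in disjoint cells, so summing them costs no factor `K`.

Mass concentrates at radius about `n^(1/p)`. Put `σ = n^(1/p - 1/2)` and `L = √(log K)`. Balls of
radius below a small, or above a large, multiple of `n^(1/p)` are treated by outward sweeps against
a weight with rescaled exponent, whose total mass is explicit. In the shell between, hyperplanes at
offset at most `ρ ~ σ L` allow an outward sweep of length `τ ~ σ / L`: it changes `|x|^2` by
`O(σ^2)`, hence `|x|^p` by `O(1)`, and contributes `O(L / σ)`. For farther hyperplanes an inward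
sweep of length of order `ρ` raises the density by a factor `K`, which pays for summing over all of
them. `lintegral_outerLayer_le` combines the four estimates, and `exists_radii_outerLayer` chooses
the parameters. -/

/-- The unnormalized radial weight `exp (-lam |y|^p / p)`. -/
noncomputable def radialExp {E : Type*} [NormedAddCommGroup E] (p lam : ℝ) (y : E) : ℝ≥0∞ :=
  ENNReal.ofReal (Real.exp (-(lam * (‖y‖ ^ p / p))))

@[fun_prop]
theorem measurable_radialExp {E : Type*} [NormedAddCommGroup E] [MeasurableSpace E]
    [OpensMeasurableSpace E] (p lam : ℝ) : Measurable (radialExp p lam : E → ℝ≥0∞) := by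
  unfold radialExp; fun_prop

/-! ### Sweeping thin sets along a normal direction. -/

section Sweep

variable {E : Type*} [NormedAddCommGroup E] [InnerProductSpace ℝ E]
  [MeasurableSpace E] [BorelSpace E]

variable [FiniteDimensional ℝ E]

/-- Rescaling the exponent of the radial weight. -/
theorem lintegral_radialExp {p lam : ℝ} (hp : 0 < p) (hl : 0 < lam) (μ : Measure E)
    [μ.IsAddHaarMeasure] :
    ∫⁻ y, radialExp p lam y ∂μ =
      ENNReal.ofReal (lam ^ (-(Module.finrank ℝ E / p : ℝ))) * ∫⁻ y, radialExp p 1 y ∂μ := by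
  have h0 : (0 : ℝ) < lam ^ (1 / p) := Real.rpow_pos_of_pos hl _
  have h1 : ∀ y : E, radialExp p lam y = radialExp p 1 (lam ^ (1 / p) • y) := by
    intro y
    unfold radialExp
    rw [norm_smul, Real.norm_of_nonneg h0.le, Real.mul_rpow h0.le (norm_nonneg _),
      ← Real.rpow_mul hl.le, one_div_mul_cancel hp.ne', Real.rpow_one]
    congr 3; ring
  simp_rw [h1]
  rw [← lintegral_map (f := radialExp p 1) (g := fun y : E => lam ^ (1 / p) • y)
    (μ := μ) (measurable_radialExp p 1) (by fun_prop)]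
  rw [Measure.map_addHaar_smul μ h0.ne', lintegral_smul_measure, smul_eq_mul]
  congr 2
  rw [abs_of_pos (by positivity), ← Real.rpow_natCast, ← Real.rpow_mul hl.le, ← Real.rpow_neg hl.le]
  congr 1; ring

/-- Sweeping a subset of a slab of width `ε` in the direction of its unit normal covers
every point with multiplicity at most `ε`. -/
theorem lintegral_sweep_le {a : E} (ha : ‖a‖ = 1) {b ε : ℝ} {S D : Set E} {I : Set ℝ}
    (hS : MeasurableSet S) (hI : MeasurableSet I)
    (hSlab : ∀ x ∈ S, b < inner ℝ a x ∧ inner ℝ a x ≤ b + ε)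
    (hD : ∀ x ∈ S, ∀ t ∈ I, x + t • a ∈ D) {ψ : E → ℝ≥0∞} (hψ : Measurable ψ)
    (hDm : MeasurableSet D) (μ : Measure E) [μ.IsAddHaarMeasure] :
    ∫⁻ x in S, (∫⁻ t in I, ψ (x + t • a)) ∂μ ≤ ENNReal.ofReal ε * ∫⁻ y in D, ψ y ∂μ := by
  have hm : Measurable (fun z : E × ℝ => ψ (z.1 + z.2 • a)) := by fun_prop
  rw [lintegral_lintegral_swap hm.aemeasurable]
  have h1 : ∀ t : ℝ, ∫⁻ x in S, ψ (x + t • a) ∂μ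
      = ∫⁻ y, S.indicator 1 (y - t • a) * ψ y ∂μ := by
    intro t
    rw [← lintegral_indicator hS,
      ← lintegral_add_right_eq_self (fun y => S.indicator 1 (y - t • a) * ψ y) (t • a)]
    refine lintegral_congr fun x => ?_
    by_cases hx : x ∈ S <;> simp [hx]
  simp_rw [h1]
  have hm2 : Measurable (fun z : ℝ × E => S.indicator (1 : E → ℝ≥0∞) (z.2 - z.1 • a) * ψ z.2) := by
    have : Measurable (S.indicator (1 : E → ℝ≥0∞)) := measurable_one.indicator hS
    fun_prop
  rw [lintegral_lintegral_swap hm2.aemeasurable, ← lintegral_indicator hDm,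
    ← lintegral_const_mul _ (hψ.indicator hDm)]
  refine lintegral_mono fun y => ?_
  by_cases hy : y ∈ D
  · rw [lintegral_mul_const _ (by
      have : Measurable (S.indicator (1 : E → ℝ≥0∞)) := measurable_one.indicator hS
      fun_prop), indicator_of_mem hy]
    gcongr
    -- For fixed `y`, the slab condition confines the times `t` with `y - t • a ∈ S` to an interval
    -- of length `ε`.
    have h2 : ∀ t : ℝ, S.indicator (1 : E → ℝ≥0∞) (y - t • a) ≤
        (Ico (inner ℝ a y - b - ε) (inner ℝ a y - b)).indicator 1 t := by
      intro t
      by_cases ht : y - t • a ∈ S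
      · obtain ⟨h3, h4⟩ := hSlab _ ht
        rw [inner_sub_right, inner_smul_right, real_inner_self_eq_norm_sq, ha] at h3 h4
        rw [indicator_of_mem (show t ∈ Ico _ _ from ⟨by linarith, by linarith⟩)]
        exact indicator_le_self' (by simp) _
      · simp [ht]
    calc ∫⁻ t in I, S.indicator (1 : E → ℝ≥0∞) (y - t • a)
        ≤ ∫⁻ t, (Ico (inner ℝ a y - b - ε) (inner ℝ a y - b)).indicator 1 t :=
          (setLIntegral_le_lintegral _ _).trans (lintegral_mono h2)
      _ = ENNReal.ofReal ε := by
          rw [lintegral_indicator_one measurableSet_Ico, Real.volume_Ico]; congr 1; ring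
  · rw [indicator_of_notMem hy, mul_zero, nonpos_iff_eq_zero,
      setLIntegral_congr_fun (g := fun _ => 0) hI]
    · simp
    · intro t ht
      have : y - t • a ∉ S := fun h => hy (by simpa using hD _ h t ht)
      simp [this]

/-- A set inside a slab has small integral if the integrand is dominated along the sweep. -/
theorem setLIntegral_le_of_sweep {a : E} (ha : ‖a‖ = 1) {b ε τ M c : ℝ} {S D : Set E}
    (hτ : 0 < τ) (hM : 0 ≤ M)
    (hS : MeasurableSet S)
    (hSlab : ∀ x ∈ S, b < inner ℝ a x ∧ inner ℝ a x ≤ b + ε)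
    (hD : ∀ x ∈ S, ∀ t ∈ Icc c (c + τ), x + t • a ∈ D) {φ ψ : E → ℝ≥0∞} (hψ : Measurable ψ)
    (hdom : ∀ x ∈ S, ∀ t ∈ Icc c (c + τ), φ x ≤ ENNReal.ofReal M * ψ (x + t • a))
    (hDm : MeasurableSet D) (μ : Measure E) [μ.IsAddHaarMeasure] :
    ∫⁻ x in S, φ x ∂μ ≤ ENNReal.ofReal (ε * (M / τ)) * ∫⁻ y in D, ψ y ∂μ := by
  have key : ENNReal.ofReal τ * ∫⁻ x in S, φ x ∂μ ≤
      ENNReal.ofReal M * (ENNReal.ofReal ε * ∫⁻ y in D, ψ y ∂μ) := by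
    rw [← lintegral_const_mul' _ _ ENNReal.ofReal_ne_top]
    calc ∫⁻ x in S, ENNReal.ofReal τ * φ x ∂μ
        ≤ ∫⁻ x in S, ENNReal.ofReal M * (∫⁻ t in Icc c (c + τ), ψ (x + t • a)) ∂μ := by
          refine setLIntegral_mono' hS fun x hx => ?_
          rw [← lintegral_const_mul' _ _ ENNReal.ofReal_ne_top]
          calc ENNReal.ofReal τ * φ x = ∫⁻ t in Icc c (c + τ), φ x := by
                rw [setLIntegral_const, Real.volume_Icc, mul_comm]; congr 2; ring
            _ ≤ _ := setLIntegral_mono' measurableSet_Icc fun t ht => hdom x hx t ht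
      _ = ENNReal.ofReal M * ∫⁻ x in S, (∫⁻ t in Icc c (c + τ), ψ (x + t • a)) ∂μ :=
          lintegral_const_mul' _ _ ENNReal.ofReal_ne_top
      _ ≤ _ := by
          gcongr
          exact lintegral_sweep_le ha hS measurableSet_Icc hSlab hD hψ hDm μ
  have hτ0 : ENNReal.ofReal τ ≠ 0 := by simpa using hτ
  calc ∫⁻ x in S, φ x ∂μ
      = (ENNReal.ofReal τ)⁻¹ * (ENNReal.ofReal τ * ∫⁻ x in S, φ x ∂μ) := by
        rw [← mul_assoc, ENNReal.inv_mul_cancel hτ0 ENNReal.ofReal_ne_top, one_mul]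
    _ ≤ (ENNReal.ofReal τ)⁻¹ * (ENNReal.ofReal M * (ENNReal.ofReal ε * ∫⁻ y in D, ψ y ∂μ)) := by
        gcongr
    _ = ENNReal.ofReal (ε * (M / τ)) * ∫⁻ y in D, ψ y ∂μ := by
        rw [mul_comm ε, ENNReal.ofReal_mul (by positivity), ENNReal.ofReal_div_of_pos hτ,
          ENNReal.div_eq_inv_mul]
        ring

end Sweep

/-! ### Irredundant half-spaces and facets. -/

section Facets

/-- If `x` satisfies all constraints of a polytope strictly except the one with normal `a`, which
is active at `x`, then the face cut out by that constraint is a facet. -/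
theorem mem_polytopeFacets_of_active {n : ℕ} {ι : Type*} (I : Finset ι) {i : ι} (hi : i ∈ I)
    {a : ι → EuclideanSpace ℝ (Fin n)} {b : ι → ℝ} (ha : a i ≠ 0)
    {x : EuclideanSpace ℝ (Fin n)} (hxi : inner ℝ (a i) x = b i)
    (hx : ∀ j ∈ I, j ≠ i → inner ℝ (a j) x < b j) :
    {y | (∀ j ∈ I, inner ℝ (a j) y ≤ b j) ∧ inner ℝ (a i) y = b i} ∈
      polytopeFacets {y | ∀ j ∈ I, inner ℝ (a j) y ≤ b j} := by
  set F : Set (EuclideanSpace ℝ (Fin n)) :=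
    {y | (∀ j ∈ I, inner ℝ (a j) y ≤ b j) ∧ inner ℝ (a i) y = b i} with hF
  have hxF : x ∈ F := by
    refine ⟨fun j hj => ?_, hxi⟩
    by_cases h : j = i
    · rw [h, hxi]
    · exact (hx j hj h).le
  refine ⟨⟨x, hxF⟩, fun _ => ⟨innerSL ℝ (a i), ?_⟩, ?_⟩
  · ext y
    simp only [hF, mem_ofPred_eq, innerSL_apply_apply]
    refine and_congr_right fun hy => ⟨fun h z hz => (hz i hi).trans h.ge, fun h => ?_⟩
    exact le_antisymm (hy i hi) (hxi ▸ h x hxF.1)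
  · have hspan : vectorSpan ℝ F = (ℝ ∙ a i)ᗮ := by
      apply le_antisymm
      · rw [vectorSpan, Submodule.span_le]
        rintro _ ⟨y, hy, z, hz, rfl⟩
        simp only [vsub_eq_sub, SetLike.mem_coe]
        rw [Submodule.mem_orthogonal_singleton_iff_inner_right, inner_sub_right, hy.2, hz.2,
          sub_self]
      -- Since the other constraints are strict at `x`, a short move along any `v` orthogonal to `a
      -- i` stays in the face.
      · intro v hv
        rw [Submodule.mem_orthogonal_singleton_iff_inner_right] at hv
        have hev : ∀ᶠ t : ℝ in 𝓝 0, ∀ j ∈ I, j ≠ i → inner ℝ (a j) (x + t • v) < b j := by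
          rw [Filter.eventually_all_finset]
          intro j hj
          by_cases h : j = i
          · simp [h]
          · have hc : Continuous fun t : ℝ => (inner ℝ (a j) (x + t • v) : ℝ) := by fun_prop
            have := hc.continuousAt.eventually_lt (x₀ := 0) (continuousAt_const (y := b j))
              (by simpa using hx j hj h)
            filter_upwards [this] with t ht _ using ht
        obtain ⟨t, ht, ht0⟩ := ((hev.filter_mono nhdsWithin_le_nhds).and
          (self_mem_nhdsWithin : Ioi (0 : ℝ) ∈ 𝓝[>] 0)).exists
        have hmem : x + t • v ∈ F := by
          have h0 : inner ℝ (a i) (x + t • v) = b i := by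
            rw [inner_add_right, inner_smul_right, hv, hxi]; simp
          refine ⟨fun j hj => ?_, h0⟩
          by_cases h : j = i
          · rw [h, h0]
          · exact (ht j hj h).le
        have h1 : t • v ∈ vectorSpan ℝ F := by
          simpa using vsub_mem_vectorSpan ℝ hmem hxF
        have := (vectorSpan ℝ F).smul_mem t⁻¹ h1
        rwa [smul_smul, inv_mul_cancel₀ (ne_of_gt ht0), one_smul] at this
    rw [hspan]
    have h1 := Submodule.finrank_add_finrank_orthogonal (ℝ ∙ a i)
    rw [finrank_span_singleton ha, finrank_euclideanSpace_fin] at h1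
    omega

/-- A point of the interior satisfies every constraint strictly. -/
theorem inner_lt_of_mem_interior {E : Type*} [NormedAddCommGroup E] [InnerProductSpace ℝ E]
    {P : Set E} {a : E} (ha : a ≠ 0) {b : ℝ} (hP : ∀ x ∈ P, inner ℝ a x ≤ b) {w : E}
    (hw : w ∈ interior P) : inner ℝ a w < b := by
  have hc : Continuous fun t : ℝ => w + t • a := by fun_prop
  have h0 : ∀ᶠ t : ℝ in 𝓝 0, w + t • a ∈ P :=
    hc.continuousAt.eventually (mem_interior_iff_mem_nhds.1 (by simpa using hw))
  obtain ⟨t, ht, ht0⟩ := ((h0.filter_mono nhdsWithin_le_nhds).and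
    (self_mem_nhdsWithin : Ioi (0 : ℝ) ∈ 𝓝[>] 0)).exists
  have h1 := hP _ ht
  rw [inner_add_right, inner_smul_right] at h1
  have h2 : 0 < inner ℝ a a := real_inner_self_pos.2 ha
  have h3 := mul_pos (show (0 : ℝ) < t from ht0) h2
  linarith

/-- A polytope with finitely many facets is cut out by at most as many half-spaces as it has
facets, and these may be taken with unit normals. -/
theorem IsConvexPolytope.exists_halfspaces {n : ℕ} {P : Set (EuclideanSpace ℝ (Fin n))}
    (hP : IsConvexPolytope P) (hfin : (polytopeFacets P).Finite) :
    ∃ (m : ℕ) (a : Fin m → EuclideanSpace ℝ (Fin n)) (b : Fin m → ℝ) (I : Finset (Fin m)),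
      I.card ≤ (polytopeFacets P).ncard ∧ (∀ i, ‖a i‖ = 1) ∧
        P = {x | ∀ i ∈ I, inner ℝ (a i) x ≤ b i} := by
  obtain ⟨⟨w, hw⟩, m, a, b, ha, hPab⟩ := hP
  have hex : ∃ k : ℕ, ∃ I : Finset (Fin m), I.card = k ∧
      P = {x | ∀ i ∈ I, inner ℝ (a i) x ≤ b i} := ⟨_, Finset.univ, rfl, by simpa using hPab⟩
  classical
  obtain ⟨I, hIc, hPI⟩ := Nat.find_spec hex
  have hmin : ∀ i ∈ I, ∃ z, (∀ j ∈ I, j ≠ i → inner ℝ (a j) z ≤ b j) ∧ b i < inner ℝ (a i) z := by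
    intro i hi
    by_contra! hcon
    refine Nat.find_min hex (m := (I.erase i).card)
      (by rw [← hIc]; exact Finset.card_erase_lt_of_mem hi) ⟨I.erase i, rfl, ?_⟩
    rw [hPI]
    ext x
    simp only [mem_ofPred_eq, Finset.mem_erase]
    refine ⟨fun h j hj => h j hj.2, fun h j hj => ?_⟩
    by_cases hji : j = i
    · subst hji
      exact hcon x fun k hk hkj => h k ⟨hkj, hk⟩
    · exact h j ⟨hji, hj⟩
  have hwI : ∀ i ∈ I, inner ℝ (a i) w < b i := fun i hi =>
    inner_lt_of_mem_interior (ha i) (fun x hx => by rw [hPI] at hx; exact hx i hi) hw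
  have hact : ∀ i ∈ I, ∃ x, inner ℝ (a i) x = b i ∧ ∀ j ∈ I, j ≠ i → inner ℝ (a j) x < b j := by
    intro i hi
    obtain ⟨z, hz, hzi⟩ := hmin i hi
    have hwi := hwI i hi
    -- The segment from the interior point `w` to `z` meets hyperplane `i` at parameter `s`; as `s <
    -- 1`, the other constraints remain strict there.
    set s : ℝ := (b i - inner ℝ (a i) w) / (inner ℝ (a i) z - inner ℝ (a i) w) with hs
    have hden : 0 < inner ℝ (a i) z - inner ℝ (a i) w := by linarith
    have hs0 : 0 < s := div_pos (by linarith) hden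
    have hs1 : s < 1 := (div_lt_one hden).2 (by linarith)
    have hlin : ∀ j, (inner ℝ (a j) (w + s • (z - w)) : ℝ) =
        (1 - s) * inner ℝ (a j) w + s * inner ℝ (a j) z := by
      intro j
      rw [inner_add_right, inner_smul_right, inner_sub_right]; ring
    refine ⟨w + s • (z - w), ?_, fun j hj hji => ?_⟩
    · have : s * (inner ℝ (a i) z - inner ℝ (a i) w) = b i - inner ℝ (a i) w :=
        div_mul_cancel₀ _ hden.ne'
      rw [hlin]; linarith
    · rw [hlin]
      nlinarith [hz j hj hji, hwI j hj]
  have hcard : I.card ≤ (polytopeFacets P).ncard := by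
    rw [← Set.ncard_coe_finset]
    refine Set.ncard_le_ncard_of_injOn
      (fun i => {y | (∀ j ∈ I, inner ℝ (a j) y ≤ b j) ∧ inner ℝ (a i) y = b i}) ?_ ?_ hfin
    · intro i hi
      obtain ⟨x, hxi, hx⟩ := hact i hi
      rw [hPI]
      exact mem_polytopeFacets_of_active I hi (ha i) hxi hx
    · intro i hi j hj hij
      obtain ⟨x, hxi, hx⟩ := hact i hi
      by_contra hne
      have hxF : x ∈ {y | (∀ j ∈ I, inner ℝ (a j) y ≤ b j) ∧ inner ℝ (a i) y = b i} := by
        refine ⟨fun k hk => ?_, hxi⟩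
        by_cases h : k = i
        · rw [h, hxi]
        · exact (hx k hk h).le
      simp only at hij
      rw [hij] at hxF
      exact (hx j hj (Ne.symm hne)).ne hxF.2
  refine ⟨m, fun i => ‖a i‖⁻¹ • a i, fun i => ‖a i‖⁻¹ * b i, I, hcard, fun i => ?_, ?_⟩
  · rw [norm_smul, norm_inv, norm_norm, inv_mul_cancel₀ (norm_ne_zero_iff.2 (ha i))]
  · rw [hPI]
    ext x
    refine forall₂_congr fun i _ => ?_
    have : 0 < ‖a i‖⁻¹ := inv_pos.2 (norm_pos_iff.2 (ha i))
    rw [real_inner_smul_left, mul_le_mul_iff_right₀ this]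

end Facets

/-! ### Perturbing a power of the norm. -/

section RealInequalities

/-- Use `1 + s ≤ exp s`, then bound the convex function `exp` by its chord over `[0, q]`. -/
theorem one_add_rpow_le_one_add_mul_exp {s q : ℝ} (hs0 : 0 ≤ s) (hs1 : s ≤ 1) (hq : 0 ≤ q) :
    (1 + s) ^ q ≤ 1 + s * Real.exp q := by
  have h1 : (1 + s) ^ q ≤ Real.exp (s * q) := by
    rw [Real.exp_mul]
    exact Real.rpow_le_rpow (by linarith) (by linarith [Real.add_one_le_exp s]) hq
  have h2 := convexOn_exp.2 (mem_univ (0 : ℝ)) (mem_univ q) (sub_nonneg.2 hs1) hs0 (by ring)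
  simp only [smul_eq_mul, mul_zero, zero_add, Real.exp_zero, mul_one] at h2
  linarith

/-- Bernoulli's inequality for exponents at most `1`; a larger exponent only decreases a power of a
base in `[0, 1]`. -/
theorem one_sub_rpow_le_one_sub_min_mul {s q : ℝ} (hs0 : 0 ≤ s) (hs1 : s ≤ 1) (hq : 0 < q) :
    (1 - s) ^ q ≤ 1 - min 1 q * s := by
  rcases hs1.eq_or_lt with rfl | hs1
  · rw [sub_self, Real.zero_rpow hq.ne']
    linarith [min_le_left 1 q]
  · calc (1 - s) ^ q ≤ (1 - s) ^ (min 1 q) :=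
        Real.rpow_le_rpow_of_exponent_ge (by linarith) (by linarith) (min_le_right _ _)
      _ ≤ 1 + min 1 q * (-s) := by
        rw [sub_eq_add_neg]
        exact rpow_one_add_le_one_add_mul_self (by linarith) (le_min zero_le_one hq.le)
          (min_le_left _ _)
      _ = _ := by ring

theorem rpow_eq_sq_rpow_half {X : ℝ} (hX : 0 ≤ X) (p : ℝ) : X ^ p = (X ^ 2) ^ (p / 2) := by
  rw [← Real.rpow_natCast, ← Real.rpow_mul hX]
  congr 1; push_cast; ring

theorem rpow_le_of_sq_le_add {p X Y w : ℝ} (hp : 0 < p) (hX : 0 < X) (hY : 0 ≤ Y) (hw0 : 0 ≤ w)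
    (hw : w ≤ X ^ 2) (h : Y ^ 2 ≤ X ^ 2 + w) :
    Y ^ p ≤ X ^ p + X ^ p * (w / X ^ 2) * Real.exp (p / 2) := by
  have hX2 : 0 < X ^ 2 := by positivity
  have hq : 0 ≤ p / 2 := by positivity
  calc Y ^ p = (Y ^ 2) ^ (p / 2) := rpow_eq_sq_rpow_half hY p
    _ ≤ (X ^ 2 * (1 + w / X ^ 2)) ^ (p / 2) := by
        refine Real.rpow_le_rpow (by positivity) ?_ hq
        rwa [mul_add, mul_one, mul_div_cancel₀ _ hX2.ne']
    _ = X ^ p * (1 + w / X ^ 2) ^ (p / 2) := by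
        rw [Real.mul_rpow hX2.le (by positivity), ← rpow_eq_sq_rpow_half hX.le]
    _ ≤ X ^ p * (1 + w / X ^ 2 * Real.exp (p / 2)) := by
        gcongr
        exact one_add_rpow_le_one_add_mul_exp (by positivity) ((div_le_one hX2).2 hw) hq
    _ = _ := by ring

theorem rpow_le_of_sq_le_sub {p X Y v : ℝ} (hp : 0 < p) (hX : 0 < X) (hY : 0 ≤ Y) (hv0 : 0 ≤ v)
    (h : Y ^ 2 ≤ X ^ 2 - v) :
    Y ^ p ≤ X ^ p - X ^ p * (v / X ^ 2) * min 1 (p / 2) := by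
  have hX2 : 0 < X ^ 2 := by positivity
  have hq : 0 < p / 2 := by positivity
  have hv1 : v / X ^ 2 ≤ 1 := (div_le_one hX2).2 (by nlinarith)
  calc Y ^ p = (Y ^ 2) ^ (p / 2) := rpow_eq_sq_rpow_half hY p
    _ ≤ (X ^ 2 * (1 - v / X ^ 2)) ^ (p / 2) := by
        refine Real.rpow_le_rpow (by positivity) ?_ hq.le
        rwa [mul_sub, mul_one, mul_div_cancel₀ _ hX2.ne']
    _ = X ^ p * (1 - v / X ^ 2) ^ (p / 2) := by
        rw [Real.mul_rpow hX2.le (by linarith), ← rpow_eq_sq_rpow_half hX.le]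
    _ ≤ X ^ p * (1 - min 1 (p / 2) * (v / X ^ 2)) := by
        gcongr
        exact one_sub_rpow_le_one_sub_min_mul (by positivity) hv1 hq
    _ = _ := by ring

end RealInequalities

/-! ### Slab estimates by radius and offset. -/

section Regions

variable {E : Type*} [NormedAddCommGroup E] [InnerProductSpace ℝ E]

theorem radialExp_le_mul_radialExp {E : Type*} [NormedAddCommGroup E] {p l₁ l₂ A : ℝ} {x y : E}
    (h : l₂ * (‖y‖ ^ p / p) ≤ A + l₁ * (‖x‖ ^ p / p)) :
    radialExp p l₁ x ≤ ENNReal.ofReal (Real.exp A) * radialExp p l₂ y := by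
  unfold radialExp
  rw [← ENNReal.ofReal_mul (Real.exp_pos _).le, ← Real.exp_add]
  exact ENNReal.ofReal_le_ofReal (Real.exp_le_exp.2 (by linarith))

theorem norm_add_smul_le_of_mem_Icc {a x : E} (ha : ‖a‖ = 1) {t τ : ℝ}
    (ht : t ∈ Icc (0 : ℝ) (0 + τ)) : ‖x + t • a‖ ≤ ‖x‖ + τ := by
  refine (norm_add_le _ _).trans ?_
  rw [norm_smul, ha, mul_one, Real.norm_of_nonneg ht.1]
  linarith [ht.2]

theorem norm_add_smul_sq {a x : E} (ha : ‖a‖ = 1) (t : ℝ) :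
    ‖x + t • a‖ ^ 2 = ‖x‖ ^ 2 + 2 * t * inner ℝ a x + t ^ 2 := by
  rw [norm_add_sq_real, inner_smul_right, norm_smul, ha, mul_one, real_inner_comm,
    Real.norm_eq_abs, sq_abs]
  ring

variable [MeasurableSpace E] [BorelSpace E] [FiniteDimensional ℝ E]
  {a : E} (ha : ‖a‖ = 1) {b ε : ℝ} {S D : Set E} (hS : MeasurableSet S)
  (hDm : MeasurableSet D)
  (hSlab : ∀ x ∈ S, b < inner ℝ a x ∧ inner ℝ a x ≤ b + ε)
  (hD : ∀ x ∈ S, ∀ t : ℝ, 0 ≤ t → x + t • a ∈ D)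
  (μ : Measure E) [μ.IsAddHaarMeasure]
include ha hS hDm hSlab hD

/-- The part of a slab of width `ε` in a small ball. -/
theorem setLIntegral_radialExp_le_of_norm_le {p r : ℝ} (hp : 0 < p) (hr : 0 < r)
    (hSr : ∀ x ∈ S, ‖x‖ ≤ r) (lam : ℝ) (hlam : 0 ≤ lam) :
    ∫⁻ x in S, radialExp p 1 x ∂μ ≤
      ENNReal.ofReal (ε * (Real.exp (lam * ((2 * r) ^ p / p)) / r)) *
        ∫⁻ y in D, radialExp p lam y ∂μ := by
  refine setLIntegral_le_of_sweep (c := 0) ha hr (Real.exp_pos _).le hS hSlab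
    (fun x hx t ht => hD x hx t ht.1) (by fun_prop) (fun x hx t ht => ?_) hDm μ
  refine radialExp_le_mul_radialExp ?_
  have h1 := norm_add_smul_le_of_mem_Icc (x := x) ha ht
  have h2 : ‖x + t • a‖ ≤ 2 * r := by linarith [hSr x hx]
  have h3 : lam * (‖x + t • a‖ ^ p / p) ≤ lam * ((2 * r) ^ p / p) := by gcongr
  have h4 : 0 ≤ 1 * (‖x‖ ^ p / p) := by positivity
  linarith

/-- The part of a slab of width `ε` outside a large ball. -/
theorem setLIntegral_radialExp_le_of_le_norm {p R : ℝ} (hp : 0 < p) (hR : 0 < R)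
    (hSR : ∀ x ∈ S, R ≤ ‖x‖) :
    ∫⁻ x in S, radialExp p 1 x ∂μ ≤
      ENNReal.ofReal (ε * (Real.exp (-(R ^ p / (2 * p))) / R)) *
        ∫⁻ y in D, radialExp p ((2 : ℝ) ^ (-(p + 1))) y ∂μ := by
  refine setLIntegral_le_of_sweep (c := 0) ha hR (Real.exp_pos _).le hS hSlab
    (fun x hx t ht => hD x hx t ht.1) (by fun_prop) (fun x hx t ht => ?_) hDm μ
  refine radialExp_le_mul_radialExp ?_
  have h1 := norm_add_smul_le_of_mem_Icc (x := x) ha ht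
  have h2 : ‖x + t • a‖ ≤ 2 * ‖x‖ := by linarith [hSR x hx]
  have h3 : ‖x + t • a‖ ^ p ≤ 2 ^ p * ‖x‖ ^ p := by
    rw [← Real.mul_rpow (by norm_num) (norm_nonneg _)]
    gcongr
  have h4 : R ^ p ≤ ‖x‖ ^ p := Real.rpow_le_rpow hR.le (hSR x hx) hp.le
  -- The scale `2 ^ (-(p + 1))` absorbs the doubling of the norm and still leaves half of the
  -- exponent as decay.
  have h5 : (2 : ℝ) ^ (-(p + 1)) * 2 ^ p = 1 / 2 := by
    rw [← Real.rpow_add (by norm_num)]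
    simp [Real.rpow_neg_one]
  calc (2 : ℝ) ^ (-(p + 1)) * (‖x + t • a‖ ^ p / p)
      ≤ (2 : ℝ) ^ (-(p + 1)) * (2 ^ p * ‖x‖ ^ p / p) := by gcongr
    _ = ‖x‖ ^ p / (2 * p) := by
        rw [mul_div_assoc, ← mul_assoc, h5]; field_simp
    _ = -(‖x‖ ^ p / (2 * p)) + 1 * (‖x‖ ^ p / p) := by field_simp; ring
    _ ≤ -(R ^ p / (2 * p)) + 1 * (‖x‖ ^ p / p) := by gcongr

/-- The part in a spherical shell of a slab close to the origin. -/
theorem setLIntegral_radialExp_le_of_inner_le {p r R B τ w : ℝ} (hp : 0 < p) (hr : 0 < r)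
    (hτ : 0 < τ) (hB : 0 ≤ B) (hw : 2 * τ * B + τ ^ 2 ≤ w) (hwr : w ≤ r ^ 2)
    (hSr : ∀ x ∈ S, r ≤ ‖x‖) (hSR : ∀ x ∈ S, ‖x‖ ≤ R) (hSB : ∀ x ∈ S, inner ℝ a x ≤ B) :
    ∫⁻ x in S, radialExp p 1 x ∂μ ≤
      ENNReal.ofReal (ε * (Real.exp (R ^ p * (w / r ^ 2) * Real.exp (p / 2) / p) / τ)) *
        ∫⁻ y in D, radialExp p 1 y ∂μ := by
  refine setLIntegral_le_of_sweep (c := 0) ha hτ (Real.exp_pos _).le hS hSlab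
    (fun x hx t ht => hD x hx t ht.1) (by fun_prop) (fun x hx t ht => ?_) hDm μ
  refine radialExp_le_mul_radialExp ?_
  have hxr := hSr x hx
  have hx0 : 0 < ‖x‖ := hr.trans_le hxr
  have hw0 : 0 ≤ w := le_trans (by positivity) hw
  have ht0 := ht.1
  have ht1 : t ≤ τ := by linarith [ht.2]
  have h1 : ‖x + t • a‖ ^ 2 ≤ ‖x‖ ^ 2 + w := by
    rw [norm_add_smul_sq ha]
    have : 2 * t * inner ℝ a x ≤ 2 * τ * B := by
      calc 2 * t * inner ℝ a x ≤ 2 * t * B := by gcongr; exact hSB x hx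
        _ ≤ 2 * τ * B := by gcongr
    have : t ^ 2 ≤ τ ^ 2 := by gcongr
    linarith
  have hrx : r ^ 2 ≤ ‖x‖ ^ 2 := by gcongr
  have h2 := rpow_le_of_sq_le_add hp hx0 (norm_nonneg _) hw0 (hwr.trans hrx) h1
  have h3 : ‖x‖ ^ p * (w / ‖x‖ ^ 2) * Real.exp (p / 2) ≤
      R ^ p * (w / r ^ 2) * Real.exp (p / 2) := by
    have := hSR x hx
    gcongr
    exact Real.rpow_nonneg (hx0.le.trans this) _
  rw [one_mul, one_mul, ← add_div]
  gcongr
  linarith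

omit hDm hD in
/-- The part in a spherical shell of a slab far from the origin. -/
theorem setLIntegral_radialExp_le_of_le_offset {p r R ρ : ℝ} (hp : 0 < p) (hr : 0 < r)
    (hρ : 0 < ρ) (hρb : ρ ≤ b)
    (hSr : ∀ x ∈ S, r ≤ ‖x‖) (hSR : ∀ x ∈ S, ‖x‖ ≤ R) :
    ∫⁻ x in S, radialExp p 1 x ∂μ ≤
      ENNReal.ofReal (ε * (Real.exp (-(r ^ p * (ρ ^ 2 / 4 / R ^ 2) * min 1 (p / 2) / p)) /
        (ρ / 2))) * ∫⁻ y, radialExp p 1 y ∂μ := by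
  -- The sweep goes inward, with `t ∈ [-ρ, -ρ/2]`, so it may leave the cell; only the whole space is
  -- available as target.
  rw [← setLIntegral_univ (μ := μ) (radialExp p 1)]
  refine setLIntegral_le_of_sweep (c := -ρ) (ψ := radialExp p 1) ha (half_pos hρ) (Real.exp_pos _).le hS hSlab
    (fun x hx t ht => mem_univ _) (by fun_prop) (fun x hx t ht => ?_) MeasurableSet.univ μ
  refine radialExp_le_mul_radialExp ?_
  have hxr := hSr x hx
  have hxR := hSR x hx
  have hx0 : 0 < ‖x‖ := hr.trans_le hxr
  have ht0 := ht.1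
  have ht1 : t ≤ -(ρ / 2) := by linarith [ht.2]
  have hxa : ρ ≤ inner ℝ a x := by linarith [(hSlab x hx).1]
  have h1 : ‖x + t • a‖ ^ 2 ≤ ‖x‖ ^ 2 - ρ ^ 2 / 4 := by
    rw [norm_add_smul_sq ha]
    nlinarith
  have h2 := rpow_le_of_sq_le_sub hp hx0 (norm_nonneg _) (by positivity) h1
  have h3 : r ^ p * (ρ ^ 2 / 4 / R ^ 2) * min 1 (p / 2) ≤
      ‖x‖ ^ p * (ρ ^ 2 / 4 / ‖x‖ ^ 2) * min 1 (p / 2) := by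
    gcongr
  rw [one_mul, one_mul, ← neg_div, ← add_div]
  gcongr
  linarith

end Regions

/-! ### Cells of the most violated constraint. -/

section Cells

variable {E : Type*} [NormedAddCommGroup E] [InnerProductSpace ℝ E]
  {ι : Type*} [LinearOrder ι]

/-- The points at which the constraint `i` is the first one to maximize `⟪a j, x⟫ - b j`. -/
def maximizerCell (I : Finset ι) (a : ι → E) (b : ι → ℝ) (i : ι) : Set E :=
  {x | ∀ j ∈ I, inner ℝ (a j) x - b j ≤ inner ℝ (a i) x - b i ∧
    (j < i → inner ℝ (a j) x - b j < inner ℝ (a i) x - b i)}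

theorem measurableSet_maximizerCell [MeasurableSpace E] [OpensMeasurableSpace E] (I : Finset ι)
    (a : ι → E) (b : ι → ℝ) (i : ι) : MeasurableSet (maximizerCell I a b i) := by
  have : maximizerCell I a b i = ⋂ j ∈ I,
      ({x | inner ℝ (a j) x - b j ≤ inner ℝ (a i) x - b i} ∩
        {x | j < i → inner ℝ (a j) x - b j < inner ℝ (a i) x - b i}) := by
    ext x; simp [maximizerCell]
  rw [this]
  refine Finset.measurableSet_biInter _ fun j _ => MeasurableSet.inter ?_ ?_
  · exact (isClosed_le (by fun_prop) (by fun_prop)).measurableSet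
  · by_cases h : j < i
    · simpa [h] using (isOpen_lt (f := fun x : E => inner ℝ (a j) x - b j)
        (g := fun x : E => inner ℝ (a i) x - b i) (by fun_prop) (by fun_prop)).measurableSet
    · simp [h]

/-- Ties go to the smallest index, which makes the cells genuinely disjoint. -/
theorem pairwiseDisjoint_maximizerCell (I : Finset ι) (a : ι → E) (b : ι → ℝ) :
    (I : Set ι).PairwiseDisjoint (maximizerCell I a b) := by
  intro i hi j hj hij
  refine Set.disjoint_left.2 fun x hxi hxj => ?_
  rcases lt_or_gt_of_ne hij with h | h
  · exact absurd ((hxj i hi).2 h) (not_lt.2 (hxi j hj).1)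
  · exact absurd ((hxi j hj).2 h) (not_lt.2 (hxj i hi).1)

/-- Cells are invariant under outward translation in the direction of their normal. -/
theorem add_smul_mem_maximizerCell {I : Finset ι} {a : ι → E} {b : ι → ℝ} (ha : ∀ i, ‖a i‖ = 1)
    {i : ι} {x : E} (hx : x ∈ maximizerCell I a b i) {t : ℝ} (ht : 0 ≤ t) :
    x + t • a i ∈ maximizerCell I a b i := by
  intro j hj
  have h1 : inner ℝ (a j) (a i) ≤ 1 := by
    simpa [ha] using real_inner_le_norm (a j) (a i)
  have h2 : inner ℝ (a i) (a i) = (1 : ℝ) := by rw [real_inner_self_eq_norm_sq, ha]; norm_num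
  have h3 : t * inner ℝ (a j) (a i) ≤ t * 1 := by gcongr
  obtain ⟨h4, h5⟩ := hx j hj
  simp only [inner_add_right, inner_smul_right, h2]
  exact ⟨by linarith, fun h => by linarith [h5 h]⟩

theorem exists_mem_maximizerCell {I : Finset ι} (hI : I.Nonempty) (a : ι → E) (b : ι → ℝ) (x : E) :
    ∃ i ∈ I, x ∈ maximizerCell I a b i := by
  classical
  obtain ⟨k, hk, hkmax⟩ := I.exists_max_image (fun j => inner ℝ (a j) x - b j) hI
  have hne : (I.filter fun i => ∀ j ∈ I, inner ℝ (a j) x - b j ≤ inner ℝ (a i) x - b i).Nonempty :=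
    ⟨k, by simp [hk]; simpa using hkmax⟩
  have hmem := Finset.min'_mem _ hne
  set i := Finset.min' _ hne with hi
  rw [Finset.mem_filter] at hmem
  refine ⟨i, hmem.1, fun j hj => ⟨hmem.2 j hj, fun hji => ?_⟩⟩
  by_contra hcon
  have : i ≤ j := Finset.min'_le _ _ (Finset.mem_filter.2
    ⟨hj, fun l hl => (hmem.2 l hl).trans (not_lt.1 hcon)⟩)
  exact absurd hji (not_lt.2 this)

theorem sum_le_mul_lintegral_of_maximizerCell [MeasurableSpace E] [OpensMeasurableSpace E]
    {μ : Measure E} {I J : Finset ι} (hJ : J ⊆ I) (a : ι → E) (b : ι → ℝ) {f : ι → ℝ≥0∞}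
    {κ : ℝ≥0∞} {ψ : E → ℝ≥0∞}
    (h : ∀ i ∈ J, f i ≤ κ * ∫⁻ y in maximizerCell I a b i, ψ y ∂μ) :
    ∑ i ∈ J, f i ≤ κ * ∫⁻ y, ψ y ∂μ := by
  calc ∑ i ∈ J, f i ≤ ∑ i ∈ J, κ * ∫⁻ y in maximizerCell I a b i, ψ y ∂μ := Finset.sum_le_sum h
    _ = κ * ∫⁻ y in ⋃ i ∈ J, maximizerCell I a b i, ψ y ∂μ := by
        rw [lintegral_biUnion_finset
          ((pairwiseDisjoint_maximizerCell I a b).subset (Finset.coe_subset.2 hJ))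
          (fun i _ => measurableSet_maximizerCell I a b i), Finset.mul_sum]
    _ ≤ _ := by gcongr; exact Measure.restrict_le_self

end Cells

/-! ### Assembling the four estimates. -/

section OuterLayer

/-- The layer of width `ε` around the polyhedron `⟪a i, x⟫ ≤ b i` cut out by shifting its
constraints. -/
def outerLayer {E ι : Type*} [NormedAddCommGroup E] [InnerProductSpace ℝ E]
    (I : Finset ι) (a : ι → E) (b : ι → ℝ) (ε : ℝ) : Set E :=
  {x | (∃ i ∈ I, b i < inner ℝ (a i) x) ∧ ∀ i ∈ I, inner ℝ (a i) x ≤ b i + ε}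

variable {E : Type*} [NormedAddCommGroup E] [InnerProductSpace ℝ E]
  {ι : Type*} [LinearOrder ι]

/-- The part of the outer layer lying in a given cell. -/
def cellLayer (I : Finset ι) (a : ι → E) (b : ι → ℝ) (ε : ℝ) (i : ι) : Set E :=
  maximizerCell I a b i ∩ {x | b i < inner ℝ (a i) x ∧ inner ℝ (a i) x ≤ b i + ε}

theorem outerLayer_subset (I : Finset ι) (a : ι → E) (b : ι → ℝ) (ε : ℝ) :
    outerLayer I a b ε ⊆ ⋃ i ∈ I, cellLayer I a b ε i := by
  rintro x ⟨⟨k, hk, hkx⟩, hx⟩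
  obtain ⟨i, hi, hxi⟩ := exists_mem_maximizerCell ⟨k, hk⟩ a b x
  simp only [mem_iUnion]
  have := (hxi k hk).1
  exact ⟨i, hi, hxi, by linarith, hx i hi⟩

variable [MeasurableSpace E] [BorelSpace E]

theorem measurableSet_cellLayer (I : Finset ι) (a : ι → E) (b : ι → ℝ) (ε : ℝ) (i : ι) :
    MeasurableSet (cellLayer I a b ε i) := by
  refine (measurableSet_maximizerCell I a b i).inter (MeasurableSet.inter ?_ ?_)
  · exact (isOpen_lt (f := fun _ : E => b i) (g := fun x : E => inner ℝ (a i) x)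
      (by fun_prop) (by fun_prop)).measurableSet
  · exact (isClosed_le (f := fun x : E => inner ℝ (a i) x) (g := fun _ : E => b i + ε)
      (by fun_prop) (by fun_prop)).measurableSet

variable [FiniteDimensional ℝ E]

/-- Bound for the weighted volume of the outer layer, with free truncation radii `r`, `R` and
threshold `ρ` separating near and far facets. -/
theorem lintegral_outerLayer_le {μ : Measure E} [μ.IsAddHaarMeasure]
    {p r R ρ τ w lam : ℝ} (hp : 0 < p) (hr : 0 < r) (hR : 0 < R) (hρ : 0 < ρ) (hτ : 0 < τ)
    (hlam : 0 < lam) (hw : 2 * τ * (2 * ρ) + τ ^ 2 ≤ w) (hwr : w ≤ r ^ 2)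
    {I : Finset ι} {a : ι → E} (b : ι → ℝ) (ha : ∀ i, ‖a i‖ = 1) {ε : ℝ} (hε : 0 ≤ ε)
    (hερ : ε ≤ ρ) :
    ∫⁻ x in outerLayer I a b ε, radialExp p 1 x ∂μ ≤
      ENNReal.ofReal (ε * (Real.exp (lam * ((2 * r) ^ p / p)) / r *
          lam ^ (-(Module.finrank ℝ E / p : ℝ)) +
        Real.exp (-(R ^ p / (2 * p))) / R *
          ((2 : ℝ) ^ (-(p + 1))) ^ (-(Module.finrank ℝ E / p : ℝ)) +
        Real.exp (R ^ p * (w / r ^ 2) * Real.exp (p / 2) / p) / τ +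
        I.card * (Real.exp (-(r ^ p * (ρ ^ 2 / 4 / R ^ 2) * min 1 (p / 2) / p)) / (ρ / 2)))) *
      ∫⁻ x, radialExp p 1 x ∂μ := by
  set Z := ∫⁻ x, radialExp p 1 x ∂μ with hZ
  set T := cellLayer I a b ε with hT
  set A₁ : Set E := {x | ‖x‖ ≤ r}
  set A₂ : Set E := {x | R ≤ ‖x‖}
  set A₃ : Set E := {x | r ≤ ‖x‖} ∩ {x | ‖x‖ ≤ R}
  have hA₁ : MeasurableSet A₁ := (isClosed_le (by fun_prop) (by fun_prop)).measurableSet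
  have hA₂ : MeasurableSet A₂ := (isClosed_le (by fun_prop) (by fun_prop)).measurableSet
  have hA₃ : MeasurableSet A₃ := ((isClosed_le (by fun_prop) (by fun_prop)).measurableSet).inter
    (isClosed_le (by fun_prop) (by fun_prop)).measurableSet
  have hTm : ∀ i, MeasurableSet (T i) := measurableSet_cellLayer I a b ε
  have hslab : ∀ i A, ∀ x ∈ T i ∩ A, b i < inner ℝ (a i) x ∧ inner ℝ (a i) x ≤ b i + ε :=
    fun i A x hx => hx.1.2
  have hD : ∀ i A, ∀ x ∈ T i ∩ A, ∀ t : ℝ, 0 ≤ t → x + t • a i ∈ maximizerCell I a b i :=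
    fun i A x hx t ht => add_smul_mem_maximizerCell ha hx.1.1 ht
  have hsum : ∫⁻ x in outerLayer I a b ε, radialExp p 1 x ∂μ ≤
      ∑ i ∈ I, ∫⁻ x in T i ∩ A₁, radialExp p 1 x ∂μ +
      ∑ i ∈ I, ∫⁻ x in T i ∩ A₂, radialExp p 1 x ∂μ +
      ∑ i ∈ I, ∫⁻ x in T i ∩ A₃, radialExp p 1 x ∂μ := by
    calc ∫⁻ x in outerLayer I a b ε, radialExp p 1 x ∂μ
        ≤ ∫⁻ x in ⋃ i ∈ I, T i, radialExp p 1 x ∂μ :=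
          lintegral_mono_set (outerLayer_subset I a b ε)
      _ = ∑ i ∈ I, ∫⁻ x in T i, radialExp p 1 x ∂μ :=
          lintegral_biUnion_finset (fun i hi j hj hij =>
            (pairwiseDisjoint_maximizerCell I a b hi hj hij).mono inter_subset_left
              inter_subset_left) (fun i _ => hTm i) _
      _ ≤ ∑ i ∈ I, (∫⁻ x in T i ∩ A₁, radialExp p 1 x ∂μ +
            ∫⁻ x in T i ∩ A₂, radialExp p 1 x ∂μ + ∫⁻ x in T i ∩ A₃, radialExp p 1 x ∂μ) := by
          refine Finset.sum_le_sum fun i _ => ?_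
          have hsub : T i ⊆ T i ∩ A₁ ∪ T i ∩ A₂ ∪ T i ∩ A₃ := by
            intro x hx
            rcases le_total ‖x‖ r with h1 | h1
            · exact Or.inl (Or.inl ⟨hx, h1⟩)
            rcases le_total R ‖x‖ with h2 | h2
            · exact Or.inl (Or.inr ⟨hx, h2⟩)
            · exact Or.inr ⟨hx, h1, h2⟩
          refine (lintegral_mono_set hsub).trans ((lintegral_union_le _ _ _).trans ?_)
          gcongr
          exact lintegral_union_le _ _ _
      _ = _ := by rw [Finset.sum_add_distrib, Finset.sum_add_distrib]
  have h₁ : ∑ i ∈ I, ∫⁻ x in T i ∩ A₁, radialExp p 1 x ∂μ ≤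
      ENNReal.ofReal (ε * (Real.exp (lam * ((2 * r) ^ p / p)) / r *
          lam ^ (-(Module.finrank ℝ E / p : ℝ)))) * Z := by
    refine (sum_le_mul_lintegral_of_maximizerCell (Finset.Subset.refl I) a b fun i _ =>
      setLIntegral_radialExp_le_of_norm_le (ha i) ((hTm i).inter hA₁)
        (measurableSet_maximizerCell I a b i) (hslab i _) (hD i _) μ hp hr
        (fun x hx => hx.2) lam hlam.le).trans_eq ?_
    rw [lintegral_radialExp hp hlam, ← mul_assoc, ← ENNReal.ofReal_mul (by positivity), mul_assoc]
  have h₂ : ∑ i ∈ I, ∫⁻ x in T i ∩ A₂, radialExp p 1 x ∂μ ≤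
      ENNReal.ofReal (ε * (Real.exp (-(R ^ p / (2 * p))) / R *
          ((2 : ℝ) ^ (-(p + 1))) ^ (-(Module.finrank ℝ E / p : ℝ)))) * Z := by
    refine (sum_le_mul_lintegral_of_maximizerCell (Finset.Subset.refl I) a b fun i _ =>
      setLIntegral_radialExp_le_of_le_norm (ha i) ((hTm i).inter hA₂)
        (measurableSet_maximizerCell I a b i) (hslab i _) (hD i _) μ hp hR
        (fun x hx => hx.2)).trans_eq ?_
    rw [lintegral_radialExp hp (by positivity), ← mul_assoc, ← ENNReal.ofReal_mul (by positivity),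
      mul_assoc]
  -- On near slabs `inner ℝ (a i) x ≤ b i + ε ≤ 2 * ρ`.
  have h₃ : ∑ i ∈ I with b i ≤ ρ, ∫⁻ x in T i ∩ A₃, radialExp p 1 x ∂μ ≤
      ENNReal.ofReal (ε * (Real.exp (R ^ p * (w / r ^ 2) * Real.exp (p / 2) / p) / τ)) * Z := by
    refine sum_le_mul_lintegral_of_maximizerCell (Finset.filter_subset _ I) a b fun i hi =>
      setLIntegral_radialExp_le_of_inner_le (ha i) ((hTm i).inter hA₃)
        (measurableSet_maximizerCell I a b i) (hslab i _) (hD i _) μ hp hr hτ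
        (by positivity : 0 ≤ 2 * ρ) hw hwr
        (fun x hx => hx.2.1) (fun x hx => hx.2.2) fun x hx => ?_
    linarith [(hslab i _ x hx).2, (Finset.mem_filter.1 hi).2]
  -- Each far slab is compared with the full mass `Z`, hence the factor `I.card`.
  have h₄ : ∑ i ∈ I with ¬ b i ≤ ρ, ∫⁻ x in T i ∩ A₃, radialExp p 1 x ∂μ ≤
      ENNReal.ofReal (ε * (I.card *
        (Real.exp (-(r ^ p * (ρ ^ 2 / 4 / R ^ 2) * min 1 (p / 2) / p)) / (ρ / 2)))) * Z := by
    set κ := Real.exp (-(r ^ p * (ρ ^ 2 / 4 / R ^ 2) * min 1 (p / 2) / p)) / (ρ / 2)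
    have hκ : 0 ≤ κ := by positivity
    calc ∑ i ∈ I with ¬ b i ≤ ρ, ∫⁻ x in T i ∩ A₃, radialExp p 1 x ∂μ
        ≤ ∑ i ∈ I with ¬ b i ≤ ρ, ENNReal.ofReal (ε * κ) * Z :=
          Finset.sum_le_sum fun i hi =>
            setLIntegral_radialExp_le_of_le_offset (ha i) ((hTm i).inter hA₃) (hslab i _) μ hp hr
              hρ (not_le.1 (Finset.mem_filter.1 hi).2).le (fun x hx => hx.2.1)
              (fun x hx => hx.2.2)
      _ ≤ ∑ i ∈ I, ENNReal.ofReal (ε * κ) * Z :=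
          Finset.sum_le_sum_of_subset (Finset.filter_subset _ I)
      _ = _ := by
          rw [Finset.sum_const, nsmul_eq_mul, ← mul_assoc, ← ENNReal.ofReal_natCast,
            ← ENNReal.ofReal_mul (Nat.cast_nonneg _)]
          congr 2; ring
  refine hsum.trans ?_
  rw [← Finset.sum_filter_add_sum_filter_not I (fun i => b i ≤ ρ)
    (fun i => ∫⁻ x in T i ∩ A₃, radialExp p 1 x ∂μ), ← add_assoc]
  refine (add_le_add (add_le_add (add_le_add h₁ h₂) h₃) h₄).trans_eq ?_
  rw [← add_mul, ← add_mul, ← add_mul, ← ENNReal.ofReal_add (by positivity) (by positivity),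
    ← ENNReal.ofReal_add (by positivity) (by positivity),
    ← ENNReal.ofReal_add (by positivity) (by positivity)]
  congr 2; ring

end OuterLayer

/-! ### Choice of parameters. -/

section Constants

/-- Choice of truncation radii for which the four error terms are of the right order. -/
theorem exists_radii_outerLayer {p : ℝ} (hp : 0 < p) : ∃ C : ℝ, 0 < C ∧ ∀ n K : ℕ, 1 ≤ n → 2 ≤ K →
    ∃ r R ρ τ w : ℝ, 0 < r ∧ 0 < R ∧ 0 < ρ ∧ 0 < τ ∧ 2 * τ * (2 * ρ) + τ ^ 2 ≤ w ∧ w ≤ r ^ 2 ∧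
      Real.exp (Real.exp p * ((2 * r) ^ p / p)) / r * Real.exp p ^ (-(n / p : ℝ)) +
        Real.exp (-(R ^ p / (2 * p))) / R * ((2 : ℝ) ^ (-(p + 1))) ^ (-(n / p : ℝ)) +
        Real.exp (R ^ p * (w / r ^ 2) * Real.exp (p / 2) / p) / τ +
        K * (Real.exp (-(r ^ p * (ρ ^ 2 / 4 / R ^ 2) * min 1 (p / 2) / p)) / (ρ / 2)) ≤
      C * (n : ℝ) ^ ((1 : ℝ) / 2 - 1 / p) * Real.sqrt (Real.log K) := by
  -- With `r ^ p = α n`, the cost of the inner sweep is `exp n`, cancelling the mass ratio `exp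
  -- (-n)` at scale `lam = exp p`.
  set α : ℝ := p * Real.exp (-p) / 2 ^ p with hα
  -- With `R ^ p = β n`, the decay `exp (-(p + 1) n / p)` beats the mass ratio `2 ^ ((p + 1) n /
  -- p)`.
  set β : ℝ := 2 * (p + 1) with hβ
  set m : ℝ := min 1 (p / 2) with hm
  have hα0 : 0 < α := by positivity
  have hβ0 : 0 < β := by positivity
  have hm0 : 0 < m := lt_min one_pos (by positivity)
  set c : ℝ := α ^ (1 / p) with hc
  set d : ℝ := β ^ (1 / p) with hd
  have hc0 : 0 < c := Real.rpow_pos_of_pos hα0 _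
  have hd0 : 0 < d := Real.rpow_pos_of_pos hβ0 _
  have hroot : ∀ x : ℝ, 0 ≤ x → (x ^ (1 / p)) ^ p = x := fun x hx => by
    rw [← Real.rpow_mul hx, one_div_mul_cancel hp.ne', Real.rpow_one]
  -- Chosen so that the gain exponent for far slabs is exactly `log K`.
  set A : ℝ := Real.sqrt (4 * d ^ 2 * p / (α * m)) with hA
  have hA0 : 0 < A := Real.sqrt_pos.2 (by positivity)
  have hA2 : A ^ 2 = 4 * d ^ 2 * p / (α * m) := Real.sq_sqrt (by positivity)
  -- Makes `2 * τ * (2 * ρ) + τ ^ 2 ≤ c ^ 2 * σ ^ 2`, using `L ≥ 1 / 2`.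
  set δ : ℝ := min 1 (c ^ 2 / (4 * A + 4)) with hδ
  have hδ0 : 0 < δ := lt_min one_pos (by positivity)
  have hδ1 : δ ≤ 1 := min_le_left _ _
  have hδ2 : δ * (4 * A + 4) ≤ c ^ 2 := by
    rw [← le_div_iff₀ (by positivity)]; exact min_le_right _ _
  set M : ℝ := Real.exp (β * Real.exp (p / 2) / p) with hM
  have hM0 : 0 < M := Real.exp_pos _
  refine ⟨2 / c + 2 / d + M / δ + 8 / A, by positivity, fun n K hn hK => ?_⟩
  have hn1 : (1 : ℝ) ≤ n := by exact_mod_cast hn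
  have hn0 : (0 : ℝ) < n := by linarith
  have hK0 : (0 : ℝ) < K := by have : 0 < K := by omega
                               exact_mod_cast this
  set L : ℝ := Real.sqrt (Real.log K) with hL
  have hlog : (1 : ℝ) / 4 ≤ Real.log K := by
    have h1 : Real.log 2 ≤ Real.log K := Real.log_le_log (by norm_num) (by exact_mod_cast hK)
    have h2 := Real.log_two_gt_d9
    linarith
  have hL2 : L ^ 2 = Real.log K := Real.sq_sqrt (by linarith)
  have hL1 : 1 / 2 ≤ L := Real.le_sqrt_of_sq_le (by norm_num; linarith)
  have hL0 : 0 < L := by linarith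
  set ν : ℝ := (n : ℝ) ^ (1 / p) with hν
  set σ : ℝ := (n : ℝ) ^ (1 / p - 1 / 2) with hσ
  have hν0 : 0 < ν := Real.rpow_pos_of_pos hn0 _
  have hσ0 : 0 < σ := Real.rpow_pos_of_pos hn0 _
  have hσν : σ ≤ ν := Real.rpow_le_rpow_of_exponent_le hn1 (by linarith)
  have hν2 : ν ^ 2 = n * σ ^ 2 := by
    have h1 : ν = n ^ (1 / 2 : ℝ) * σ := by
      rw [hσ, hν, ← Real.rpow_add hn0]; congr 1; ring
    rw [h1, mul_pow, ← Real.rpow_natCast, ← Real.rpow_mul hn0.le]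
    norm_num
  have hinv : (n : ℝ) ^ ((1 : ℝ) / 2 - 1 / p) = 1 / σ := by
    rw [eq_div_iff hσ0.ne', hσ, ← Real.rpow_add hn0]; norm_num
  have hνp : ν ^ p = n := hroot _ hn0.le
  have hrp : (c * ν) ^ p = α * n := by
    rw [Real.mul_rpow hc0.le hν0.le, hνp, hroot _ hα0.le]
  have hRp : (d * ν) ^ p = β * n := by
    rw [Real.mul_rpow hd0.le hν0.le, hνp, hroot _ hβ0.le]
  refine ⟨c * ν, d * ν, A * σ * L, δ * σ / L, c ^ 2 * σ ^ 2, by positivity, by positivity,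
    by positivity, by positivity, ?_, ?_, ?_⟩
  · have h1 : 2 * (δ * σ / L) * (2 * (A * σ * L)) = 4 * A * δ * σ ^ 2 := by field_simp; ring
    have h2 : (δ * σ / L) ^ 2 ≤ 4 * δ * σ ^ 2 := by
      have hLi : 1 / L ≤ 2 := by rw [div_le_iff₀ hL0]; linarith
      have h3 : (1 / L) ^ 2 ≤ 2 ^ 2 := by gcongr
      calc (δ * σ / L) ^ 2 = δ * δ * σ ^ 2 * (1 / L) ^ 2 := by ring
        _ ≤ δ * 1 * σ ^ 2 * 2 ^ 2 := by gcongr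
        _ = 4 * δ * σ ^ 2 := by ring
    rw [h1]
    have h3 := mul_le_mul_of_nonneg_right hδ2 (sq_nonneg σ)
    linarith
  · rw [mul_pow]; gcongr
  · have ht1 : Real.exp (Real.exp p * ((2 * (c * ν)) ^ p / p)) / (c * ν) *
        Real.exp p ^ (-(n / p : ℝ)) = 1 / (c * ν) := by
      rw [Real.mul_rpow (by norm_num) (by positivity), hrp, ← Real.exp_mul, div_mul_eq_mul_div,
        ← Real.exp_add]
      congr 1
      rw [Real.exp_eq_one_iff, hα]
      have h2p : (0 : ℝ) < 2 ^ p := by positivity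
      have he : Real.exp p * Real.exp (-p) = 1 := by rw [← Real.exp_add]; simp
      field_simp
      linear_combination (n : ℝ) * he
    have ht2 : Real.exp (-((d * ν) ^ p / (2 * p))) / (d * ν) *
        ((2 : ℝ) ^ (-(p + 1))) ^ (-(n / p : ℝ)) ≤ 1 / (d * ν) := by
      rw [hRp, div_mul_eq_mul_div]
      gcongr
      have h2 : ((2 : ℝ) ^ (-(p + 1))) ^ (-(n / p : ℝ)) ≤ Real.exp ((p + 1) * (n / p)) := by
        rw [← Real.rpow_mul (by norm_num), neg_mul_neg, ← Real.exp_one_rpow]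
        exact Real.rpow_le_rpow (by norm_num) (by linarith [Real.exp_one_gt_d9]) (by positivity)
      calc _ ≤ Real.exp (-(β * n / (2 * p))) * Real.exp ((p + 1) * (n / p)) := by gcongr
        _ = 1 := by
          rw [← Real.exp_add, Real.exp_eq_one_iff, hβ]; field_simp; ring
    have ht3 : (d * ν) ^ p * (c ^ 2 * σ ^ 2 / (c * ν) ^ 2) = β := by
      rw [hRp, mul_pow, hν2]; field_simp
    have ht4 : K * Real.exp (-((c * ν) ^ p * ((A * σ * L) ^ 2 / 4 / (d * ν) ^ 2) * m / p)) = 1 := by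
      have : (c * ν) ^ p * ((A * σ * L) ^ 2 / 4 / (d * ν) ^ 2) * m / p = Real.log K := by
        rw [hrp, mul_pow d, hν2, mul_pow, mul_pow, hA2, ← hL2]; field_simp
      rw [this, Real.exp_neg, Real.exp_log hK0, mul_inv_cancel₀ hK0.ne']
    have h2L : 1 ≤ 2 * L := by linarith
    have hfrac : ∀ e : ℝ, 0 < e → 1 / (e * ν) ≤ 2 / e * (1 / σ) * L := fun e he => by
      calc 1 / (e * ν) ≤ 1 / (e * σ) * 1 := by rw [mul_one]; gcongr
        _ ≤ 1 / (e * σ) * (2 * L) := by gcongr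
        _ = _ := by field_simp
    have hfar : K * (Real.exp (-((c * ν) ^ p * ((A * σ * L) ^ 2 / 4 / (d * ν) ^ 2) * m / p)) /
        (A * σ * L / 2)) ≤ 8 / A * (1 / σ) * L := by
      rw [← mul_div_assoc, ht4]
      calc 1 / (A * σ * L / 2) = 2 / (A * σ * L) * (1 * 1) := by field_simp
        _ ≤ 2 / (A * σ * L) * ((2 * L) * (2 * L)) := by gcongr
        _ = _ := by field_simp; ring
    have hnear : M / (δ * σ / L) = M / δ * (1 / σ) * L := by field_simp
    rw [ht1, ht3, hinv, ← hM, hnear]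
    linarith [hfrac c hc0, hfrac d hd0, ht2, hfar]

end Constants

/-- Integrability need not be checked: otherwise the Bochner integral is `0` by convention, and so
is its inverse. -/
theorem ENNReal.ofReal_integral_inv_mul_lintegral_le_one {α : Type*} [MeasurableSpace α]
    {μ : Measure α} {f : α → ℝ} (hf : ∀ x, 0 ≤ f x) :
    ENNReal.ofReal (∫ x, f x ∂μ)⁻¹ * ∫⁻ x, ENNReal.ofReal (f x) ∂μ ≤ 1 := by
  by_cases h : Integrable f μ
  · rw [← ofReal_integral_eq_lintegral_ofReal h (Filter.Eventually.of_forall hf),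
      ← ENNReal.ofReal_mul (inv_nonneg.2 (integral_nonneg hf)), ← ENNReal.ofReal_one]
    exact ENNReal.ofReal_le_ofReal inv_mul_le_one
  · simp [integral_undef h]

/-! ### From the measure to the surface area. -/

section SurfaceArea

variable {n : ℕ} {p : ℝ}

theorem expMeasure_apply_eq {s : Set (EuclideanSpace ℝ (Fin n))} :
    expMeasure n p s =
      ENNReal.ofReal (expNormConst n p) * ∫⁻ x in s, radialExp p 1 x := by
  have h0 : 0 ≤ expNormConst n p := inv_nonneg.2 (integral_nonneg fun _ => (Real.exp_pos _).le)
  rw [expMeasure, withDensity_apply', ← lintegral_const_mul' _ _ ENNReal.ofReal_ne_top]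
  refine lintegral_congr fun x => ?_
  rw [expDensity, radialExp, one_mul, ENNReal.ofReal_mul h0]

theorem expNormConst_mul_lintegral_le_one :
    ENNReal.ofReal (expNormConst n p) *
      ∫⁻ x : EuclideanSpace ℝ (Fin n), radialExp p 1 x ≤ 1 := by
  simpa [expNormConst, radialExp] using
    ENNReal.ofReal_integral_inv_mul_lintegral_le_one (μ := volume)
      (f := fun y : EuclideanSpace ℝ (Fin n) => Real.exp (-(‖y‖ ^ p / p)))
      fun _ => (Real.exp_pos _).le

/-- The Minkowski layer of a polyhedron is contained in its outer layer. -/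
theorem add_smul_closedBall_diff_subset {E ι : Type*} [NormedAddCommGroup E]
    [InnerProductSpace ℝ E] (I : Finset ι) {a : ι → E} (ha : ∀ i, ‖a i‖ = 1) (b : ι → ℝ) {ε : ℝ}
    (hε : 0 ≤ ε) :
    ({x | ∀ i ∈ I, inner ℝ (a i) x ≤ b i} + ε • Metric.closedBall (0 : E) 1) \
      {x | ∀ i ∈ I, inner ℝ (a i) x ≤ b i} ⊆ outerLayer I a b ε := by
  rintro _ ⟨⟨y, hy, _, ⟨z, hz, rfl⟩, rfl⟩, hx⟩
  refine ⟨by simpa using hx, fun i hi => ?_⟩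
  have h1 : inner ℝ (a i) z ≤ 1 := by
    refine (real_inner_le_norm _ _).trans ?_
    simpa [ha] using hz
  have h2 : ε * inner ℝ (a i) z ≤ ε * 1 := by gcongr
  have h3 := hy i hi
  simp only [inner_add_right, inner_smul_right]
  linarith

end SurfaceArea

theorem mainTheorem2 (p : ℝ) (hp : 0 < p) :
    ∃ C : ℝ, 0 < C ∧
      ∀ (n K : ℕ) (P : Set (EuclideanSpace ℝ (Fin n))),
        1 ≤ n → 2 ≤ K → IsConvexPolytope P → (polytopeFacets P).ncard = K →
          expSurfaceArea n p P ≤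
            ENNReal.ofReal
              (C * (n : ℝ) ^ ((1 : ℝ) / 2 - 1 / p) * Real.sqrt (Real.log (K : ℝ))) := by
  obtain ⟨C, hC, hbound⟩ := exists_radii_outerLayer hp
  refine ⟨C, hC, fun n K P hn hK hP hcard => ?_⟩
  obtain ⟨m, a, b, I, hI, ha, rfl⟩ :=
    -- `ncard` vanishes on infinite sets, so `K ≥ 2` forces finitely many facets.
    hP.exists_halfspaces (Set.finite_of_ncard_pos (by omega))
  rw [hcard] at hI
  obtain ⟨r, R, ρ, τ, w, hr, hR, hρ, hτ, hw, hwr, hle⟩ := hbound n K hn hK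
  set B := C * (n : ℝ) ^ ((1 : ℝ) / 2 - 1 / p) * Real.sqrt (Real.log (K : ℝ)) with hB
  refine Filter.liminf_le_of_frequently_le' (Filter.Eventually.frequently ?_)
  filter_upwards [Ioo_mem_nhdsGT hρ] with ε hε
  refine ENNReal.div_le_of_le_mul ?_
  have hcardR : (I.card : ℝ) ≤ K := by exact_mod_cast hI
  calc expMeasure n p _ ≤ expMeasure n p (outerLayer I a b ε) :=
        measure_mono (add_smul_closedBall_diff_subset I ha b hε.1.le)
    _ ≤ ENNReal.ofReal (expNormConst n p) * (ENNReal.ofReal (ε * B) *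
          ∫⁻ x : EuclideanSpace ℝ (Fin n), radialExp p 1 x) := by
        rw [expMeasure_apply_eq]
        gcongr
        refine (lintegral_outerLayer_le hp hr hR hρ hτ (Real.exp_pos p) hw hwr b ha hε.1.le
          hε.2.le).trans ?_
        gcongr
        · exact hε.1.le
        · rw [finrank_euclideanSpace_fin]
          refine le_trans ?_ hle
          gcongr
    _ = ENNReal.ofReal (ε * B) * (ENNReal.ofReal (expNormConst n p) *
          ∫⁻ x : EuclideanSpace ℝ (Fin n), radialExp p 1 x) := by ring
    _ ≤ ENNReal.ofReal (ε * B) * 1 := by gcongr; exact expNormConst_mul_lintegral_le_one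
    _ = ENNReal.ofReal B * ENNReal.ofReal ε := by
        rw [mul_one, mul_comm ε, ENNReal.ofReal_mul (by positivity)]
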